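/- Setting. Fix $n>2$. $Ty_n$ is classical, extensional higher-order logic (simple type theory) whose types are built from the truth type $t$ and individual types $e_1,\dots,e_n$ by function types $(\alpha\beta)$ (functions from $\alpha$ to $\beta$, associated to the right) and product types $\alpha\times\beta$. Its terms are built from variables and constants by application, $\lambda$-abstraction, equality, pairing and projections, and it has a description operator $\iota_{(\alpha t)\alpha}$ with $\vdash\iota_{(\alpha t)\alpha}\,\lambda x_\alpha(y_\alpha=x_\alpha)=y_\alpha$ at every type $\alpha$. Write $s:=e_n$ and $c:=e_{n-1}$. Let $\mathcal A=\{a_1,\dots,a_N\}$ be a finite alphabet. $Ty_n^{\mathcal A}$ is $Ty_n$, with some family of non-logical constants that includes distinct constants $C^0_s,\dots,C^N_s$ and a constant $C^0_{sss}$ (written as $+$), together with the axioms $\forall x_s(x+C^0_s=x\wedge C^0_s+x=x)$, $\forall x_s\forall y_s\forall z_s\,((x+y)+z=x+(y+z))$ and $\forall x_s\forall y_s\forall z_s\,(x+C^i_s+y\ne x+C^j_s+z)$ for $1\le i<j\le N$. $Ty_n^{\mathcal A+}$ is an extension of $Ty_n^{\mathcal A}$ by additional non-logical constants. For $w\in\mathcal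 A^*$ let $T_A(\varepsilon)=C^0_s$, $T_A(a_i)=C^i_s$, and $T_A(a_iw)=C^i_s+T_A(w)$ for $w\neq\varepsilon$. Let $\mathcal T_\alpha$ be the set of $Ty_n^{\mathcal A}$ terms of type $\alpha$. For a term $B$ of type $\alpha$, $(=B)$ stands for $\lambda x_\alpha(x_\alpha=B)$, and disjunctions of predicates are pointwise. Below, $\vdash$ without assumptions is provability in $Ty_n^{\mathcal A}$, and $\Delta\vdash$ is derivability from $\Delta$ in $Ty_n^{\mathcal A+}$. An $\alpha$-language is a relation $\mathcal L\subset\mathcal A^*\times\mathcal T_\alpha$. Given a set $\Delta$ of $Ty_n^{\mathcal A+}$ formulas and a $Ty_n^{\mathcal A+}$ term $L$ of type $s\alpha t$, the pair $(\Delta,L)$ is a *pseudo-canonic representation* of $\mathcal L$ if 1. $\Delta$ is consistent and, for all $w\in\mathcal A^*$ and $A\in\mathcal T_\alpha$, $(w,A)\in\mathcal L\iff\Delta\vdash L\,T_A(w)\,A$ (that is, $(\Delta,L)$ represents $\mathcal L$); 2. for every $w\in\mathcal A^*$ there is a finite, possibly empty, set $\{A^1,\dots,A^l\}\subset\mathcal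 T_\alpha$ with $\Delta\vdash L\,T_A(w)=\bigvee_{i=1}^l(=A^i)$ (the right side being $\lambda x_\alpha\,\mathsf F$ if $l=0$); 3. $\Delta$ is conservative over $Ty_n^{\mathcal A}$: for every $Ty_n^{\mathcal A}$ formula $A_t$, $\vdash A_t$ iff $\Delta\vdash A_t$. Put $\bar\alpha:=c(c\times\alpha)$. A *context-dependent $\alpha$-language* is an $\bar\alpha$-language. Terms of type $\bar\alpha$ are identified with pairs of terms of types $cc$ and $c\alpha$: the pair $(x_{cc},y_{c\alpha})$ corresponds to $\lambda z_c(x_{cc}z_c,\,y_{c\alpha}z_c)$, and $p_{\bar\alpha}$ corresponds to $(\lambda z_c\,\pi_1(p\,z_c),\ \lambda z_c\,\pi_2(p\,z_c))$; functions of a pair are identified with functions of two arguments. For a context-dependent $\alpha$-language $\mathcal L$ and a $Ty_n^{\mathcal A}$ term $C_c$ of type $c$, the *context instantiation* of $\mathcal L$ is the $\alpha$-language $$\mathcal L\downarrow C_c:=\{(w,B)\;:\;\text{there is }A\in\mathcal T_{\bar\alpha}\text{ with }(w,A)\in\mathcal L\text{ and }\vdash CI(C_c)\,A\,B\},$$ where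 $CI(C_c):=\lambda x_{cc}\lambda y_{c\alpha}(=y_{c\alpha}\,C_c)$. Define also the $Ty_n^{\mathcal A}$ term $$(\downarrow_{(s\bar\alpha t)cs\alpha t}):=\lambda z_{s\bar\alpha t}\,\lambda z_c\,\lambda x_s\,\lambda y_\alpha\,\exists x_{cc}\,\exists y_{c\alpha}\,\bigl(z_{s\bar\alpha t}\,x_s\,x_{cc}\,y_{c\alpha}\ \wedge\ y_\alpha=y_{c\alpha}\,z_c\bigr),$$ and write $L\downarrow C_c$ for this term applied to $L$ and $C_c$. **Proposition 9.3.** Let $\mathcal L$ be a context-dependent $\alpha$-language, let $(\Delta,L_{s\bar\alpha t})$ be a pseudo-canonic representation of $\mathcal L$, and let $C_c$ be a $Ty_n^{\mathcal A}$ term of type $c$. Then $(\Delta,\,L_{s\bar\alpha t}\downarrow C_c)$ is a pseudo-canonic representation of the context instantiation $\mathcal L\downarrow C_c$. -/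

import Mathlib

/-! ## The sorted type theory `Ty_n` with products and descriptions -/

universe u v

namespace TyN

/-- Types over `n` sorts of individuals: the truth type `t`, the individual types `e i`
(`i : Fin n`, counted from `0`), functional types and product types. -/
inductive Ty (n : ℕ) : Type
  | t : Ty n
  | e : Fin n → Ty n
  | fn : Ty n → Ty n → Ty n
  | prod : Ty n → Ty n → Ty n

/-- `α ⇒ β` is the type of functions from `α` to `β`. -/
infixr:60 " ⇒ " => Ty.fn
/-- `α ⊠ β` is the type of pairs. -/
infixr:70 " ⊠ " => Ty.prod

/-- The symbolic type: the last individual type `e_n`. -/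
abbrev Ty.s {n : ℕ} [h : Fact (2 < n)] : Ty n := Ty.e ⟨n - 1, by have := h.out; omega⟩

/-- The context type: the last but one individual type `e_{n-1}`. -/
abbrev Ty.c {n : ℕ} [h : Fact (2 < n)] : Ty n := Ty.e ⟨n - 2, by have := h.out; omega⟩

/-- The type `c(c × α)` of the meanings of a context-dependent `α`-language. -/
abbrev Ty.ctx {n : ℕ} [Fact (2 < n)] (α : Ty n) : Ty n := Ty.c ⇒ (Ty.c ⊠ α)

/-- De Bruijn indices of type `α` into the list `Γ` of the types of the enclosing binders. -/
inductive BVar {n : ℕ} : List (Ty n) → Ty n → Type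
  | zero {Γ : List (Ty n)} {α : Ty n} : BVar (α :: Γ) α
  | succ {Γ : List (Ty n)} {α β : Ty n} : BVar Γ α → BVar (β :: Γ) α

/-- Well-typed terms over the family `K` of constants.  Free variables are named: `fvar i` at
type `α` is the variable `x^i_α`.  Bound variables are de Bruijn indices, so that terms which differ
only in the names of bound variables are identified; `Γ` lists the types of the binders in whose
scope the term stands.  The terms of the theory in the usual sense are those with `Γ = []`.
`iota` is the description operator, of type `(αt)α`. -/
inductive Term {n : ℕ} (K : Ty n → Type u) : List (Ty n) → Ty n → Type u
  | bvar {Γ : List (Ty n)} {α : Ty n} : BVar Γ α → Term K Γ α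
  | fvar {Γ : List (Ty n)} {α : Ty n} : ℕ → Term K Γ α
  | const {Γ : List (Ty n)} {α : Ty n} : K α → Term K Γ α
  | app {Γ : List (Ty n)} {α β : Ty n} : Term K Γ (α ⇒ β) → Term K Γ α → Term K Γ β
  | lam {Γ : List (Ty n)} {α β : Ty n} : Term K (α :: Γ) β → Term K Γ (α ⇒ β)
  | eq {Γ : List (Ty n)} {α : Ty n} : Term K Γ α → Term K Γ α → Term K Γ Ty.t
  | pair {Γ : List (Ty n)} {α β : Ty n} : Term K Γ α → Term K Γ β → Term K Γ (α ⊠ β)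
  | fst {Γ : List (Ty n)} {α β : Ty n} : Term K Γ (α ⊠ β) → Term K Γ α
  | snd {Γ : List (Ty n)} {α β : Ty n} : Term K Γ (α ⊠ β) → Term K Γ β
  | iota {Γ : List (Ty n)} {α : Ty n} : Term K Γ ((α ⇒ Ty.t) ⇒ α)

namespace Term

variable {n : ℕ} {K : Ty n → Type u}

/-! ### Renaming and capture-free substitution of bound variables -/

/-- A renaming, extended under one more binder. -/
def liftRen {Γ Δ : List (Ty n)} (ρ : ∀ α : Ty n, BVar Γ α → BVar Δ α) (β : Ty n) :
    ∀ α : Ty n, BVar (β :: Γ) α → BVar (β :: Δ) α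
  | _, .zero => .zero
  | _, .succ x => .succ (ρ _ x)

def rename : ∀ {Γ Δ : List (Ty n)}, (∀ α : Ty n, BVar Γ α → BVar Δ α) →
    ∀ {α : Ty n}, Term K Γ α → Term K Δ α
  | _, _, ρ, _, .bvar x => .bvar (ρ _ x)
  | _, _, _, _, .fvar i => .fvar i
  | _, _, _, _, .const k => .const k
  | _, _, ρ, _, .app f a => .app (f.rename ρ) (a.rename ρ)
  | _, _, ρ, _, .lam b => .lam (b.rename (liftRen ρ _))
  | _, _, ρ, _, .eq a b => .eq (a.rename ρ) (b.rename ρ)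
  | _, _, ρ, _, .pair a b => .pair (a.rename ρ) (b.rename ρ)
  | _, _, ρ, _, .fst p => .fst (p.rename ρ)
  | _, _, ρ, _, .snd p => .snd (p.rename ρ)
  | _, _, _, _, .iota => .iota

/-- The same term, placed under one more binder (which it does not mention). -/
def weaken {Γ : List (Ty n)} {α β : Ty n} (a : Term K Γ α) : Term K (β :: Γ) α :=
  a.rename fun _ x => .succ x

/-- There are no indices into the empty list. -/
def emptyRen {Γ : List (Ty n)} : ∀ α : Ty n, BVar [] α → BVar Γ α := nofun

/-- A term without dangling indices, placed under arbitrary binders. -/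
def lift {Γ : List (Ty n)} {α : Ty n} (a : Term K [] α) : Term K Γ α :=
  a.rename emptyRen

/-- A substitution, extended under one more binder. -/
def liftSubst {Γ Δ : List (Ty n)} (σ : ∀ α : Ty n, BVar Γ α → Term K Δ α) (β : Ty n) :
    ∀ α : Ty n, BVar (β :: Γ) α → Term K (β :: Δ) α
  | _, .zero => .bvar .zero
  | _, .succ x => (σ _ x).weaken

def subst : ∀ {Γ Δ : List (Ty n)}, (∀ α : Ty n, BVar Γ α → Term K Δ α) →
    ∀ {α : Ty n}, Term K Γ α → Term K Δ α
  | _, _, σ, _, .bvar x => σ _ x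
  | _, _, _, _, .fvar i => .fvar i
  | _, _, _, _, .const k => .const k
  | _, _, σ, _, .app f a => .app (f.subst σ) (a.subst σ)
  | _, _, σ, _, .lam b => .lam (b.subst (liftSubst σ _))
  | _, _, σ, _, .eq a b => .eq (a.subst σ) (b.subst σ)
  | _, _, σ, _, .pair a b => .pair (a.subst σ) (b.subst σ)
  | _, _, σ, _, .fst p => .fst (p.subst σ)
  | _, _, σ, _, .snd p => .snd (p.subst σ)
  | _, _, _, _, .iota => .iota

/-- The substitution that replaces the index `0` by `b` and lowers the other indices. -/
def instSubst {Γ : List (Ty n)} {β : Ty n} (b : Term K Γ β) :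
    ∀ α : Ty n, BVar (β :: Γ) α → Term K Γ α
  | _, .zero => b
  | _, .succ x => .bvar x

/-- `a.inst b` is the result of substituting `b` for the outermost bound variable of `a`. -/
def inst {Γ : List (Ty n)} {α β : Ty n} (a : Term K (β :: Γ) α) (b : Term K Γ β) : Term K Γ α :=
  a.subst (instSubst b)

/-- Translation of terms along a map of constants. -/
def mapConst {K' : Ty n → Type v} (f : ∀ α : Ty n, K α → K' α) :
    ∀ {Γ : List (Ty n)} {α : Ty n}, Term K Γ α → Term K' Γ α
  | _, _, .bvar x => .bvar x
  | _, _, .fvar i => .fvar i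
  | _, _, .const k => .const (f _ k)
  | _, _, .app g a => .app (g.mapConst f) (a.mapConst f)
  | _, _, .lam b => .lam (b.mapConst f)
  | _, _, .eq a b => .eq (a.mapConst f) (b.mapConst f)
  | _, _, .pair a b => .pair (a.mapConst f) (b.mapConst f)
  | _, _, .fst p => .fst (p.mapConst f)
  | _, _, .snd p => .snd (p.mapConst f)
  | _, _, .iota => .iota

/-! ### Logical connectives, defined from equality -/

variable {Γ : List (Ty n)}

/-- `T` is `(λ x_t, x_t) = (λ x_t, x_t)`. -/
def tt : Term K Γ Ty.t := .eq (.lam (α := Ty.t) (.bvar .zero)) (.lam (.bvar .zero))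

/-- `F` is `(λ x_t, T) = (λ x_t, x_t)`. -/
def ff : Term K Γ Ty.t := .eq (.lam (α := Ty.t) tt) (.lam (.bvar .zero))

/-- `¬ a` is `a = F`. -/
def neg (a : Term K Γ Ty.t) : Term K Γ Ty.t := .eq a ff

/-- `a ∧ b` is `(λ g_{ttt}, g T T) = (λ g_{ttt}, g a b)`. -/
def and (a b : Term K Γ Ty.t) : Term K Γ Ty.t :=
  .eq (.lam (α := Ty.t ⇒ Ty.t ⇒ Ty.t) (.app (.app (.bvar .zero) tt) tt))
    (.lam (.app (.app (.bvar .zero) a.weaken) b.weaken))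

/-- `a ∨ b` is `¬ (¬ a ∧ ¬ b)`. -/
def or (a b : Term K Γ Ty.t) : Term K Γ Ty.t := neg (and (neg a) (neg b))

/-- `∀ x_α, a` is `(λ x_α, T) = (λ x_α, a)`. -/
def all (α : Ty n) (a : Term K (α :: Γ) Ty.t) : Term K Γ Ty.t := .eq (.lam tt) (.lam a)

/-- `∃ x_α, a` is `¬ ∀ x_α, ¬ a`. -/
def ex (α : Ty n) (a : Term K (α :: Γ) Ty.t) : Term K Γ Ty.t := neg (all α (neg a))

/-- The predicate `(= a)`, that is `λ x_α, x_α = a`. -/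
def eqTo {α : Ty n} (a : Term K Γ α) : Term K Γ (α ⇒ Ty.t) := .lam (.eq (.bvar .zero) a.weaken)

/-- Disjunction of predicates, `λ x_α, p x_α ∨ q x_α`. -/
def predOr {α : Ty n} (p q : Term K Γ (α ⇒ Ty.t)) : Term K Γ (α ⇒ Ty.t) :=
  .lam (or (.app p.weaken (.bvar .zero)) (.app q.weaken (.bvar .zero)))

/-- `(= a₁) ∨ … ∨ (= a_l)` for a finite list of terms; `λ x_α, F` for the empty list. -/
def eqAny {α : Ty n} (l : List (Term K Γ α)) : Term K Γ (α ⇒ Ty.t) :=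
  l.foldr (fun a p => predOr (eqTo a) p) (.lam ff)

end Term

/-! ### Provability -/

/-- `Prov H A`: the formula `A` is derivable from the finite list `H` of assumptions in the pure
theory (classical higher-order logic with extensionality, descriptions and pairs).  Rule R of the
equational presentation of type theory is split into `leibniz` and `xi`; `propExt` and `boolCases`
say that the truth type has exactly the values `T` and `F`. -/
inductive Prov {n : ℕ} {K : Ty n → Type u} :
    ∀ {Γ : List (Ty n)}, List (Term K Γ Ty.t) → Term K Γ Ty.t → Prop
  | hyp {Γ : List (Ty n)} {H : List (Term K Γ Ty.t)} {A : Term K Γ Ty.t} : A ∈ H → Prov H A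
  | refl {Γ : List (Ty n)} {H : List (Term K Γ Ty.t)} {α : Ty n} (a : Term K Γ α) :
      Prov H (.eq a a)
  /-- Equals may be substituted for equals. -/
  | leibniz {Γ : List (Ty n)} {H : List (Term K Γ Ty.t)} {α : Ty n} {a b : Term K Γ α}
      (P : Term K (α :: Γ) Ty.t) : Prov H (.eq a b) → Prov H (P.inst a) → Prov H (P.inst b)
  /-- Equals may be substituted for equals under a binder whose variable is not free in `H`. -/
  | xi {Γ : List (Ty n)} {H : List (Term K Γ Ty.t)} {α β : Ty n} {a b : Term K (α :: Γ) β} :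
      Prov (H.map Term.weaken) (.eq a b) → Prov H (.eq (.lam a) (.lam b))
  | beta {Γ : List (Ty n)} {H : List (Term K Γ Ty.t)} {α β : Ty n} (a : Term K (α :: Γ) β)
      (b : Term K Γ α) : Prov H (.eq (.app (.lam a) b) (a.inst b))
  | eta {Γ : List (Ty n)} {H : List (Term K Γ Ty.t)} {α β : Ty n} (f : Term K Γ (α ⇒ β)) :
      Prov H (.eq (.lam (.app f.weaken (.bvar .zero))) f)
  | propExt {Γ : List (Ty n)} {H : List (Term K Γ Ty.t)} {A B : Term K Γ Ty.t} :
      Prov (A :: H) B → Prov (B :: H) A → Prov H (.eq A B)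
  | boolCases {Γ : List (Ty n)} {H : List (Term K Γ Ty.t)} (P : Term K (Ty.t :: Γ) Ty.t)
      (A : Term K Γ Ty.t) : Prov H (P.inst .tt) → Prov H (P.inst .ff) → Prov H (P.inst A)
  | fst_pair {Γ : List (Ty n)} {H : List (Term K Γ Ty.t)} {α β : Ty n} (a : Term K Γ α)
      (b : Term K Γ β) : Prov H (.eq (.fst (.pair a b)) a)
  | snd_pair {Γ : List (Ty n)} {H : List (Term K Γ Ty.t)} {α β : Ty n} (a : Term K Γ α)
      (b : Term K Γ β) : Prov H (.eq (.snd (.pair a b)) b)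
  | pair_eta {Γ : List (Ty n)} {H : List (Term K Γ Ty.t)} {α β : Ty n} (p : Term K Γ (α ⊠ β)) :
      Prov H (.eq (.pair (.fst p) (.snd p)) p)
  /-- The description of `λ x_α, a = x_α` is `a`. -/
  | descr {Γ : List (Ty n)} {H : List (Term K Γ Ty.t)} {α : Ty n} (a : Term K Γ α) :
      Prov H (.eq (.app .iota (.lam (.eq a.weaken (.bvar .zero)))) a)

/-! ## The symbolic extension over a finite alphabet -/

/-- The non-logical constants of the theory over the alphabet `Fin N`: any family of constants with
distinct distinguished constants `C^0_s, …, C^N_s` and a constant `C^0_{sss}`. -/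
structure Sig (n N : ℕ) [Fact (2 < n)] where
  Const : Ty n → Type u
  sym : Fin (N + 1) ↪ Const Ty.s
  cat : Const (Ty.s ⇒ Ty.s ⇒ Ty.s)

namespace Sig

variable {n N : ℕ} [Fact (2 < n)]

/-- The extension by a family `D` of additional constants. -/
def extend (S : Sig.{u} n N) (D : Ty n → Type v) : Sig.{max u v} n N where
  Const α := S.Const α ⊕ D α
  sym := S.sym.trans ⟨Sum.inl, Sum.inl_injective⟩
  cat := Sum.inl S.cat

/-- The set `T_α` of terms of type `α`. -/
abbrev Tm (S : Sig.{u} n N) (α : Ty n) : Type u := Term S.Const [] α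

/-- A term of the original theory, regarded as a term of the extended one. -/
def incl (S : Sig.{u} n N) (D : Ty n → Type v) {α : Ty n} (a : S.Tm α) : (S.extend D).Tm α :=
  a.mapConst fun _ k => Sum.inl k

variable (S : Sig.{u} n N)

/-- The symbol `C^i_s`. -/
def symTm {Γ : List (Ty n)} (i : Fin (N + 1)) : Term S.Const Γ Ty.s := .const (S.sym i)

/-- `a + b`, that is `C^0_{sss} a b`. -/
def catTm {Γ : List (Ty n)} (a b : Term S.Const Γ Ty.s) : Term S.Const Γ Ty.s :=
  .app (.app (.const S.cat) a) b

/-- `∀ x_s, (x + C^0 = x) ∧ (C^0 + x = x)`. -/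
def axUnit : S.Tm Ty.t :=
  .all Ty.s (.and (.eq (S.catTm (.bvar .zero) (S.symTm 0)) (.bvar .zero))
    (.eq (S.catTm (S.symTm 0) (.bvar .zero)) (.bvar .zero)))

/-- `∀ x_s, ∀ y_s, ∀ z_s, (x + y) + z = x + (y + z)`. -/
def axAssoc : S.Tm Ty.t :=
  .all Ty.s (.all Ty.s (.all Ty.s
    (.eq (S.catTm (S.catTm (.bvar (.succ (.succ .zero))) (.bvar (.succ .zero))) (.bvar .zero))
      (S.catTm (.bvar (.succ (.succ .zero))) (S.catTm (.bvar (.succ .zero)) (.bvar .zero))))))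

/-- `∀ x_s, ∀ y_s, ∀ z_s, x + C^i + y ≠ x + C^j + z`. -/
def axDistinct (i j : Fin (N + 1)) : S.Tm Ty.t :=
  .all Ty.s (.all Ty.s (.all Ty.s
    (.neg (.eq
      (S.catTm (S.catTm (.bvar (.succ (.succ .zero))) (S.symTm i)) (.bvar (.succ .zero)))
      (S.catTm (S.catTm (.bvar (.succ (.succ .zero))) (S.symTm j)) (.bvar .zero))))))

/-- The non-logical axioms of the theory (all of them are sentences). -/
def symAx : Set (S.Tm Ty.t) :=
  {S.axUnit, S.axAssoc} ∪ {A | ∃ i j : Fin (N + 1), 1 ≤ (i : ℕ) ∧ i < j ∧ A = S.axDistinct i j}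

/-- `Δ ⊢ A` in the theory with the constants `S` and the non-logical axioms above. -/
def Derives (Δ : Set (S.Tm Ty.t)) (A : S.Tm Ty.t) : Prop :=
  ∃ H : List (S.Tm Ty.t), (∀ B ∈ H, B ∈ S.symAx ∪ Δ) ∧ Prov H A

def Consistent (Δ : Set (S.Tm Ty.t)) : Prop := ¬ S.Derives Δ .ff

/-- The term `T_A(w)` for a word `w`; the letter `a_i` (`i = 1, …, N`) is `i - 1 : Fin N`. -/
def wordTm : List (Fin N) → S.Tm Ty.s
  | [] => S.symTm 0
  | [a] => S.symTm a.succ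
  | a :: b :: w => S.catTm (S.symTm a.succ) (wordTm (b :: w))

/-! ## Languages and their representations -/

/-- An `α`-language: a relation between words and terms of type `α`. -/
abbrev Lang (α : Ty n) : Type u := Set (List (Fin N) × S.Tm α)

/-- A context-dependent `α`-language. -/
abbrev CtxLang (α : Ty n) : Type u := S.Lang (Ty.ctx α)

/-- A semantic rule. -/
abbrev SemRule (α β : Ty n) : Type u := Set (S.Tm α × S.Tm β)

variable {S}

/-- Application of a semantic rule to a language. -/
def Lang.applyRule {α β : Ty n} (L : S.Lang α) (R : S.SemRule α β) : S.Lang β :=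
  {q | ∃ A : S.Tm α, (q.1, A) ∈ L ∧ (A, q.2) ∈ R}

/-- The semantic rule represented by a term `R_{αβt}`: the pairs `(A, B)` with `⊢ R A B`. -/
def SemRule.ofTerm {α β : Ty n} (R : S.Tm (α ⇒ β ⇒ Ty.t)) : S.SemRule α β :=
  {q | S.Derives ∅ (.app (.app R q.1) q.2)}

/-- `L` is represented by `(Δ, P)`, where `Δ` and `P` may use the additional constants `D`. -/
def Lang.RepresentedBy {D : Ty n → Type v} {α : Ty n} (L : S.Lang α)
    (Δ : Set ((S.extend D).Tm Ty.t)) (P : (S.extend D).Tm (Ty.s ⇒ α ⇒ Ty.t)) : Prop :=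
  (S.extend D).Consistent Δ ∧
    ∀ (w : List (Fin N)) (A : S.Tm α),
      (w, A) ∈ L ↔
        (S.extend D).Derives Δ (.app (.app P ((S.extend D).wordTm w)) (S.incl D A))

variable (S) in
/-- Adding `Δ` to the extended theory is conservative over the original theory. -/
def Conservative {D : Ty n → Type v} (Δ : Set ((S.extend D).Tm Ty.t)) : Prop :=
  ∀ A : S.Tm Ty.t, S.Derives ∅ A ↔ (S.extend D).Derives Δ (S.incl D A)

/-- `(Δ, P)` is a pseudo-canonic representation of `L`. -/
def Lang.PseudoCanonic {D : Ty n → Type v} {α : Ty n} (L : S.Lang α)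
    (Δ : Set ((S.extend D).Tm Ty.t)) (P : (S.extend D).Tm (Ty.s ⇒ α ⇒ Ty.t)) : Prop :=
  L.RepresentedBy Δ P ∧
    (∀ w : List (Fin N), ∃ l : List (S.Tm α),
      (S.extend D).Derives Δ
        (.eq (.app P ((S.extend D).wordTm w)) (Term.eqAny (l.map (S.incl D))))) ∧
    S.Conservative Δ

/-! ## Context instantiation -/

/-- `CI(C_c)`, that is `λ x_{cc}, λ y_{cα}, (= y_{cα} C_c)`. -/
def ciTm {α : Ty n} (C : S.Tm Ty.c) :
    S.Tm ((Ty.c ⇒ Ty.c) ⇒ (Ty.c ⇒ α) ⇒ α ⇒ Ty.t) :=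
  .lam (.lam (Term.eqTo (.app (.bvar .zero) C.lift)))

/-- Under the identification of `c(c × α)` with `(cc) × (cα)`, and of functions of a pair with
functions of two arguments, a term `R` of type `(cc)(cα)β` is a term of type `c(c × α)β`, namely
`λ p, R (λ z_c, π₁ (p z_c)) (λ z_c, π₂ (p z_c))`. -/
def uncurryCtx {α β : Ty n} (R : S.Tm ((Ty.c ⇒ Ty.c) ⇒ (Ty.c ⇒ α) ⇒ β)) :
    S.Tm (Ty.ctx α ⇒ β) :=
  .lam (.app (.app R.lift
    (.lam (.fst (.app (.bvar (.succ .zero)) (.bvar .zero)))))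
    (.lam (.snd (.app (.bvar (.succ .zero)) (.bvar .zero)))))

/-- The context instantiation of a context-dependent language: application of the semantic rule
that is represented by `CI(C_c)`. -/
def CtxLang.instantiate {α : Ty n} (L : S.CtxLang α) (C : S.Tm Ty.c) : S.Lang α :=
  Lang.applyRule L (SemRule.ofTerm (uncurryCtx (ciTm C)))

/-- The term of type `c(c × α)` that corresponds to the pair of `x_{cc}` and `y_{cα}`:
`λ z_c, (x z_c, y z_c)`. -/
def pairCtx {Γ : List (Ty n)} {α : Ty n} (x : Term S.Const Γ (Ty.c ⇒ Ty.c))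
    (y : Term S.Const Γ (Ty.c ⇒ α)) : Term S.Const Γ (Ty.ctx α) :=
  .lam (.pair (.app x.weaken (.bvar .zero)) (.app y.weaken (.bvar .zero)))

variable (S) in
/-- The instantiation operator, of type `(s(c(c × α))t)csαt`:
`λ z, λ z_c, λ x_s, λ y_α, ∃ x_{cc}, ∃ y_{cα}, (z x_s (x_{cc}, y_{cα}) ∧ y_α = y_{cα} z_c)`. -/
def dnOp (α : Ty n) :
    S.Tm ((Ty.s ⇒ Ty.ctx α ⇒ Ty.t) ⇒ Ty.c ⇒ Ty.s ⇒ α ⇒ Ty.t) :=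
  .lam (.lam (.lam (.lam (.ex (Ty.c ⇒ Ty.c) (.ex (Ty.c ⇒ α) (.and
    (.app
      (.app (.bvar (.succ (.succ (.succ (.succ (.succ .zero))))))
        (.bvar (.succ (.succ (.succ .zero)))))
      (pairCtx (.bvar (.succ .zero)) (.bvar .zero)))
    (.eq (.bvar (.succ (.succ .zero)))
      (.app (.bvar .zero) (.bvar (.succ (.succ (.succ (.succ .zero)))))))))))))

/-- The term `P ↓ C_c`, that is the instantiation operator applied to `P` and `C_c`. -/
def dnTm {α : Ty n} (P : S.Tm (Ty.s ⇒ Ty.ctx α ⇒ Ty.t)) (C : S.Tm Ty.c) :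
    S.Tm (Ty.s ⇒ α ⇒ Ty.t) :=
  .app (.app (S.dnOp α) P) C

end Sig

end TyN

namespace TyN

namespace Term

variable {n : ℕ} {K : Ty n → Type u}

/-! ### Renaming and substitution -/

theorem rename_rename {Γ Δ Θ : List (Ty n)} {α : Ty n} (a : Term K Γ α)
    (ρ : ∀ α : Ty n, BVar Γ α → BVar Δ α) (τ : ∀ α : Ty n, BVar Δ α → BVar Θ α) :
    (a.rename ρ).rename τ = a.rename fun _ x => τ _ (ρ _ x) := by
  induction a generalizing Δ Θ with
  | lam b ih =>
    simp only [rename, ih]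
    congr 2
    funext _ x
    cases x <;> rfl
  | _ => simp only [rename, *]

theorem subst_rename {Γ Δ Θ : List (Ty n)} {α : Ty n} (a : Term K Γ α)
    (ρ : ∀ α : Ty n, BVar Γ α → BVar Δ α) (σ : ∀ α : Ty n, BVar Δ α → Term K Θ α) :
    (a.rename ρ).subst σ = a.subst fun _ x => σ _ (ρ _ x) := by
  induction a generalizing Δ Θ with
  | lam b ih =>
    simp only [rename, subst, ih]
    congr 2
    funext _ x
    cases x <;> rfl
  | _ => simp only [rename, subst, *]

theorem rename_subst {Γ Δ Θ : List (Ty n)} {α : Ty n} (a : Term K Γ α)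
    (σ : ∀ α : Ty n, BVar Γ α → Term K Δ α) (ρ : ∀ α : Ty n, BVar Δ α → BVar Θ α) :
    (a.subst σ).rename ρ = a.subst fun _ x => (σ _ x).rename ρ := by
  induction a generalizing Δ Θ with
  | lam b ih =>
    simp only [rename, subst, ih]
    congr 2
    funext _ x
    cases x
    · rfl
    · simp [liftSubst, weaken, rename_rename, liftRen]
  | _ => simp only [rename, subst, *]

theorem liftSubst_bvar {Γ : List (Ty n)} (β : Ty n) :
    liftSubst (K := K) (fun (α : Ty n) (x : BVar Γ α) => .bvar x) β = fun _ x => .bvar x := by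
  funext _ x
  cases x <;> rfl

theorem subst_bvar {Γ : List (Ty n)} {α : Ty n} (a : Term K Γ α) :
    (a.subst fun _ x => .bvar x) = a := by
  induction a with
  | lam b ih => simp only [subst, liftSubst_bvar, ih]
  | _ => simp only [subst, *]

theorem mapConst_rename {K' : Ty n → Type v} (f : ∀ α : Ty n, K α → K' α) {Γ Δ : List (Ty n)}
    {α : Ty n} (a : Term K Γ α) (ρ : ∀ α : Ty n, BVar Γ α → BVar Δ α) :
    (a.rename ρ).mapConst f = (a.mapConst f).rename ρ := by
  induction a generalizing Δ with
  | _ => simp only [rename, mapConst, *]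

@[simp] theorem weaken_subst_liftSubst {Γ Δ : List (Ty n)} {α β : Ty n} (a : Term K Γ α)
    (σ : ∀ α : Ty n, BVar Γ α → Term K Δ α) :
    (a.weaken (β := β)).subst (liftSubst σ β) = (a.subst σ).weaken := by
  simp only [weaken, subst_rename, rename_subst]
  rfl

@[simp] theorem weaken_subst_instSubst {Γ : List (Ty n)} {α β : Ty n} (a : Term K Γ α)
    (b : Term K Γ β) : a.weaken.subst (instSubst b) = a := by
  simp only [weaken, subst_rename]
  exact subst_bvar a

@[simp] theorem weaken_inst {Γ : List (Ty n)} {α β : Ty n} (a : Term K Γ α) (b : Term K Γ β) :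
    a.weaken.inst b = a := weaken_subst_instSubst a b

theorem rename_eq_subst {Γ Δ : List (Ty n)} {α : Ty n} (a : Term K Γ α)
    (ρ : ∀ α : Ty n, BVar Γ α → BVar Δ α) : a.rename ρ = a.subst fun _ x => .bvar (ρ _ x) := by
  rw [← subst_bvar (a.rename ρ), subst_rename]

@[simp] theorem lift_subst {Γ Δ : List (Ty n)} {α : Ty n} (a : Term K [] α)
    (σ : ∀ α : Ty n, BVar Γ α → Term K Δ α) : a.lift.subst σ = a.lift := by
  rw [lift, subst_rename, lift, rename_eq_subst]
  congr 1
  funext _ x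
  cases x

@[simp] theorem lift_nil {α : Ty n} (a : Term K [] α) : (a.lift : Term K [] α) = a := by
  refine Eq.trans ?_ (subst_bvar a)
  rw [lift, rename_eq_subst]
  congr 1
  funext _ x
  cases x

section Connectives

variable {Γ Δ : List (Ty n)} (σ : ∀ α : Ty n, BVar Γ α → Term K Δ α)

@[simp] theorem tt_subst : (tt : Term K Γ Ty.t).subst σ = tt := rfl

@[simp] theorem neg_subst (a : Term K Γ Ty.t) : (neg a).subst σ = neg (a.subst σ) := rfl

@[simp] theorem and_subst (a b : Term K Γ Ty.t) :
    (and a b).subst σ = and (a.subst σ) (b.subst σ) := by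
  simp [and, subst, liftSubst]

@[simp] theorem or_subst (a b : Term K Γ Ty.t) :
    (or a b).subst σ = or (a.subst σ) (b.subst σ) := by
  simp [or]

@[simp] theorem all_subst {α : Ty n} (a : Term K (α :: Γ) Ty.t) :
    (all α a).subst σ = all α (a.subst (liftSubst σ α)) := by
  simp [all, subst]

@[simp] theorem ex_subst {α : Ty n} (a : Term K (α :: Γ) Ty.t) :
    (ex α a).subst σ = ex α (a.subst (liftSubst σ α)) := by
  simp [ex]

@[simp] theorem eqTo_subst {α : Ty n} (a : Term K Γ α) : (eqTo a).subst σ = eqTo (a.subst σ) := by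
  simp [eqTo, subst, liftSubst]

@[simp] theorem predOr_subst {α : Ty n} (p q : Term K Γ (α ⇒ Ty.t)) :
    (predOr p q).subst σ = predOr (p.subst σ) (q.subst σ) := by
  simp [predOr, subst, liftSubst]

@[simp] theorem eqAny_subst {α : Ty n} (l : List (Term K Γ α)) :
    (eqAny l).subst σ = eqAny (l.map fun a => a.subst σ) := by
  induction l with
  | nil => rfl
  | cons a l ih =>
    have h : (predOr (eqTo a) (eqAny l)).subst σ
      = predOr (eqTo (a.subst σ)) (eqAny (l.map fun a => a.subst σ)) := by simp [ih]
    exact h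

theorem eqAny_weaken {α β : Ty n} (l : List (Term K Γ α)) :
    (eqAny l).weaken (β := β) = eqAny (l.map weaken) := by
  rw [weaken, rename_eq_subst, eqAny_subst]
  congr 1
  exact List.map_congr_left fun a _ => (rename_eq_subst a _).symm

theorem mapConst_eqAny {K' : Ty n → Type v} (f : ∀ α : Ty n, K α → K' α) {α : Ty n}
    (l : List (Term K Γ α)) : (eqAny l).mapConst f = eqAny (l.map fun a => a.mapConst f) := by
  induction l with
  | nil => rfl
  | cons a l ih =>
    have h : (predOr (eqTo a) (eqAny l)).mapConst f
      = predOr (eqTo (a.mapConst f)) (eqAny (l.map fun a => a.mapConst f)) := by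
      rw [← ih]
      simp [predOr, eqTo, or, neg, and, ff, tt, mapConst, weaken, mapConst_rename]
    exact h

end Connectives

end Term
namespace Prov

open Term

variable {n : ℕ} {K : Ty n → Type u} {Γ : List (Ty n)} {H H' : List (Term K Γ Ty.t)}
  {α β : Ty n}

/-! ### Equality -/

theorem mono {A : Term K Γ Ty.t} (h : Prov H A) (hs : H ⊆ H') : Prov H' A := by
  induction h with
  | hyp h => exact hyp (hs h)
  | refl a => exact refl a
  | leibniz P _ _ ih ih' => exact leibniz P (ih hs) (ih' hs)
  | xi _ ih => exact xi (ih (List.map_subset _ hs))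
  | beta a b => exact beta a b
  | eta f => exact eta f
  | propExt _ _ ih ih' =>
    exact propExt (ih (List.cons_subset_cons _ hs)) (ih' (List.cons_subset_cons _ hs))
  | boolCases P A _ _ ih ih' => exact boolCases P A (ih hs) (ih' hs)
  | fst_pair a b => exact fst_pair a b
  | snd_pair a b => exact snd_pair a b
  | pair_eta p => exact pair_eta p
  | descr a => exact descr a

theorem weak {A B : Term K Γ Ty.t} (h : Prov H A) : Prov (B :: H) A :=
  h.mono (List.subset_cons_self _ _)

theorem head {A : Term K Γ Ty.t} : Prov (A :: H) A := hyp List.mem_cons_self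

theorem congr {a b : Term K Γ α} (f : Term K (α :: Γ) β) (h : Prov H (.eq a b)) :
    Prov H (.eq (f.inst a) (f.inst b)) := by
  have := leibniz (.eq (f.inst a).weaken f) h
  simp only [inst, subst, weaken_subst_instSubst] at this
  exact this (refl _)

theorem symm {a b : Term K Γ α} (h : Prov H (.eq a b)) : Prov H (.eq b a) := by
  have := leibniz (.eq (.bvar .zero) a.weaken) h
  simp only [inst, subst, weaken_subst_instSubst] at this
  exact this (refl _)

theorem trans {a b c : Term K Γ α} (h : Prov H (.eq a b)) (h' : Prov H (.eq b c)) :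
    Prov H (.eq a c) := by
  have := leibniz (.eq a.weaken (.bvar .zero)) h'
  simp only [inst, subst, weaken_subst_instSubst] at this
  exact this h

theorem app_arg (f : Term K Γ (α ⇒ β)) {a b : Term K Γ α} (h : Prov H (.eq a b)) :
    Prov H (.eq (.app f a) (.app f b)) := by
  have := congr (.app f.weaken (.bvar .zero)) h
  simp only [inst, subst, weaken_subst_instSubst] at this
  exact this

theorem app_fun {f g : Term K Γ (α ⇒ β)} (a : Term K Γ α) (h : Prov H (.eq f g)) :
    Prov H (.eq (.app f a) (.app g a)) := by
  have := congr (.app (.bvar .zero) a.weaken) h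
  simp only [inst, subst, weaken_subst_instSubst] at this
  exact this

theorem eq_congr {a a' b b' : Term K Γ α} (h : Prov H (.eq a a')) (h' : Prov H (.eq b b')) :
    Prov H (.eq (.eq a b) (.eq a' b')) := by
  have h₁ := congr (.eq (.bvar .zero) b.weaken) h
  have h₂ := congr (.eq a'.weaken (.bvar .zero)) h'
  simp only [inst, subst, weaken_subst_instSubst] at h₁ h₂
  exact h₁.trans h₂

theorem snd_congr {a b : Term K Γ (α ⊠ β)} (h : Prov H (.eq a b)) :
    Prov H (.eq (.snd a) (.snd b)) := congr (.snd (.bvar .zero)) h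

theorem pair_congr {a a' : Term K Γ α} {b b' : Term K Γ β} (h : Prov H (.eq a a'))
    (h' : Prov H (.eq b b')) : Prov H (.eq (.pair a b) (.pair a' b')) := by
  have h₁ := congr (.pair (.bvar .zero) b.weaken) h
  have h₂ := congr (.pair a'.weaken (.bvar .zero)) h'
  simp only [inst, subst, weaken_subst_instSubst] at h₁ h₂
  exact h₁.trans h₂

theorem eq_mp {A B : Term K Γ Ty.t} (h : Prov H (.eq A B)) (hA : Prov H A) : Prov H B :=
  leibniz (.bvar .zero) h hA

theorem app_weaken_lam {H : List (Term K (α :: Γ) Ty.t)}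
    (b : Term K (α :: Γ) β) :
    Prov H (.eq (.app (b.lam).weaken (.bvar .zero)) b) := by
  have h := beta (H := H) (b.rename (liftRen (fun _ x => .succ x) α)) (.bvar .zero)
  have e : (b.rename (liftRen (fun _ x => .succ x) α)).inst (.bvar .zero) = b := by
    rw [inst, subst_rename]
    refine Eq.trans ?_ (subst_bvar b)
    congr 1
    funext _ x
    cases x <;> rfl
  rw [e] at h
  exact h

/-! ### Propositional logic -/

theorem tt_intro : Prov H .tt := refl _

theorem eq_tt {A : Term K Γ Ty.t} (h : Prov H A) : Prov H (.eq A .tt) := propExt tt_intro h.weak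

theorem app_lam_and (g : Term K Γ (Ty.t ⇒ Ty.t ⇒ Ty.t)) (A B : Term K Γ Ty.t) :
    Prov H (.eq (.app (.lam (.app (.app (.bvar .zero) A.weaken) B.weaken)) g)
      (.app (.app g A) B)) := by
  have := beta (H := H) (.app (.app (.bvar .zero) A.weaken) B.weaken) g
  simp only [inst, subst, weaken_subst_instSubst] at this
  exact this

theorem and_intro {A B : Term K Γ Ty.t} (hA : Prov H A) (hB : Prov H B) : Prov H (.and A B) := by
  have h := congr (.and .tt (.bvar .zero)) hB.eq_tt.symm
  have h' := congr (.and (.bvar .zero) B.weaken) hA.eq_tt.symm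
  simp only [inst, subst, and_subst, tt_subst, weaken_subst_instSubst] at h h'
  exact (h.trans h').eq_mp (refl _)

theorem and_elim {A B : Term K Γ Ty.t} (g : Term K Γ (Ty.t ⇒ Ty.t ⇒ Ty.t))
    (h : Prov H (.and A B)) :
    Prov H (.eq (.app (.app g .tt) .tt) (.app (.app g A) B)) :=
  (app_lam_and g .tt .tt).symm.trans ((app_fun g h).trans (app_lam_and g A B))

theorem app_proj_left (A B : Term K Γ Ty.t) :
    Prov H (.eq (.app (.app (.lam (.lam (.bvar (.succ .zero)))) A) B) A) := by
  have h' := beta (H := H) (A.weaken (β := Ty.t)) B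
  rw [weaken_inst] at h'
  exact (app_fun B (beta (.lam (.bvar (.succ .zero))) A)).trans h'

theorem app_proj_right (A B : Term K Γ Ty.t) :
    Prov H (.eq (.app (.app (.lam (.lam (.bvar .zero))) A) B) B) :=
  (app_fun B (beta (.lam (.bvar .zero)) A)).trans (beta (.bvar .zero) B)

theorem and_left {A B : Term K Γ Ty.t} (h : Prov H (.and A B)) : Prov H A :=
  (((app_proj_left _ _).symm.trans (h.and_elim _)).trans (app_proj_left _ _)).eq_mp tt_intro

theorem and_right {A B : Term K Γ Ty.t} (h : Prov H (.and A B)) : Prov H B :=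
  (((app_proj_right _ _).symm.trans (h.and_elim _)).trans (app_proj_right _ _)).eq_mp tt_intro

theorem imp_intro {A B : Term K Γ Ty.t} (h : Prov (A :: H) B) : Prov H (.eq (.and A B) A) :=
  propExt head.and_left (and_intro head h)

theorem imp_elim {A B : Term K Γ Ty.t} (h : Prov H (.eq (.and A B) A)) (hA : Prov H A) :
    Prov H B := (h.symm.eq_mp hA).and_right

theorem cut {A B : Term K Γ Ty.t} (h : Prov H A) (h' : Prov (A :: H) B) : Prov H B :=
  h'.imp_intro.imp_elim h

theorem ff_elim {A : Term K Γ Ty.t} (h : Prov H .ff) : Prov H A := by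
  have := (beta .tt A).symm.trans ((app_fun A h).trans (beta (.bvar .zero) A))
  exact this.eq_mp tt_intro

theorem neg_intro {A : Term K Γ Ty.t} (h : Prov (A :: H) .ff) : Prov H (.neg A) :=
  propExt h head.ff_elim

theorem neg_elim {A B : Term K Γ Ty.t} (h : Prov H (.neg A)) (hA : Prov H A) : Prov H B :=
  (h.eq_mp hA).ff_elim

theorem by_cases (A : Term K Γ Ty.t) {B : Term K Γ Ty.t} (h : Prov (A :: H) B)
    (h' : Prov (.neg A :: H) B) : Prov H B := by
  let imp {Θ : List (Ty n)} (a b : Term K Θ Ty.t) : Term K Θ Ty.t := .eq (.and a b) a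
  have key := boolCases (H := H) (imp (imp (.bvar .zero) B.weaken)
    (imp (imp (.neg (.bvar .zero)) B.weaken) B.weaken)) A
  simp only [imp, inst, subst, and_subst, neg_subst, weaken_subst_instSubst, instSubst] at key
  refine imp_elim (imp_elim (key ?_ ?_) h.imp_intro) h'.imp_intro
  · exact imp_intro (imp_intro (head.weak.imp_elim tt_intro))
  · exact imp_intro (imp_intro (head.imp_elim (refl _)))

theorem or_left {A B : Term K Γ Ty.t} (h : Prov H A) : Prov H (.or A B) :=
  neg_intro (head.and_left.neg_elim h.weak)

theorem or_right {A B : Term K Γ Ty.t} (h : Prov H B) : Prov H (.or A B) :=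
  neg_intro (head.and_right.neg_elim h.weak)

theorem or_elim {A B G : Term K Γ Ty.t} (h : Prov H (.or A B)) (hA : Prov (A :: H) G)
    (hB : Prov (B :: H) G) : Prov H G := by
  refine by_cases A hA (by_cases B (hB.mono ?_) ?_)
  · exact List.cons_subset_cons _ (List.subset_cons_self _ _)
  · exact h.weak.weak.neg_elim (and_intro head.weak head)

/-! ### Quantifiers -/

theorem ex_intro {A : Term K (α :: Γ) Ty.t} (b : Term K Γ α) (h : Prov H (A.inst b)) :
    Prov H (.ex α A) := by
  refine neg_intro ?_
  have h₁ := (beta (H := .all α (.neg A) :: H) .tt b).symm.trans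
    ((app_fun b head).trans (beta (.neg A) b))
  have h₂ : Prov (.all α (.neg A) :: H) (.neg (A.inst b)) := h₁.eq_mp tt_intro
  exact h₂.neg_elim h.weak

theorem ex_elim {A : Term K (α :: Γ) Ty.t} {B : Term K Γ Ty.t} (h : Prov H (.ex α A))
    (h' : Prov (A :: H.map weaken) B.weaken) : Prov H B := by
  refine by_cases B head ?_
  refine neg_elim h.weak (xi (eq_tt (neg_intro ?_)).symm)
  have hB : Prov (A :: (Term.neg B :: H).map weaken) (.neg B.weaken) :=
    hyp (List.mem_cons_of_mem _ List.mem_cons_self)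
  refine hB.neg_elim (h'.mono ?_)
  exact List.cons_subset_cons _ (List.map_subset _ (List.subset_cons_self _ _))

/-! ### Finite disjunctions of the predicates `(= a)` -/

theorem eqTo_iff (a b : Term K Γ α) : Prov H (.eq (.app (.eqTo a) b) (.eq b a)) := by
  have := beta (H := H) (.eq (.bvar .zero) a.weaken) b
  simp only [inst, subst, weaken_subst_instSubst] at this
  exact this

theorem eqAny_nil (b : Term K Γ α) : Prov H (.eq (.app (.eqAny []) b) .ff) :=
  beta .ff b

theorem eqAny_cons (a : Term K Γ α) (l : List (Term K Γ α)) (b : Term K Γ α) :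
    Prov H (.eq (.app (.eqAny (a :: l)) b) (.or (.app (.eqTo a) b) (.app (.eqAny l) b))) := by
  have := beta (H := H) (.or (.app (eqTo a).weaken (.bvar .zero))
    (.app (eqAny l).weaken (.bvar .zero))) b
  simp only [inst, subst, or_subst, weaken_subst_instSubst] at this
  exact this

theorem eqAny_intro {l : List (Term K Γ α)} {a b : Term K Γ α} (ha : a ∈ l)
    (h : Prov H (.eq b a)) : Prov H (.app (.eqAny l) b) := by
  induction l with
  | nil => simp at ha
  | cons c l ih =>
    refine (eqAny_cons c l b).symm.eq_mp ?_
    rcases List.mem_cons.1 ha with rfl | ha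
    · exact or_left ((eqTo_iff _ _).symm.eq_mp h)
    · exact or_right (ih ha)

theorem eqAny_elim {l : List (Term K Γ α)} {b : Term K Γ α} {G : Term K Γ Ty.t}
    (h : Prov H (.app (.eqAny l) b)) (h' : ∀ a ∈ l, Prov (.eq b a :: H) G) : Prov H G := by
  induction l generalizing H with
  | nil => exact ((eqAny_nil b).eq_mp h).ff_elim
  | cons c l ih =>
    refine ((eqAny_cons c l b).eq_mp h).or_elim ?_ (ih head fun a ha => ?_)
    · refine cut ((eqTo_iff _ _).eq_mp head) ((h' c List.mem_cons_self).mono ?_)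
      exact List.cons_subset_cons _ (List.subset_cons_self _ _)
    · refine (h' a (List.mem_cons_of_mem _ ha)).mono ?_
      exact List.cons_subset_cons _ (List.subset_cons_self _ _)

end Prov

/-! ### Definition by cases -/

namespace Term

variable {n : ℕ} {K : Ty n → Type u} {Γ : List (Ty n)} {α : Ty n}

/-- The term `if A then a else b`, that is `ι x_α, (A ∧ a = x_α) ∨ (¬ A ∧ b = x_α)`. -/
def ite (A : Term K Γ Ty.t) (a b : Term K Γ α) : Term K Γ α :=
  .app .iota (.lam (.or (.and A.weaken (.eq a.weaken (.bvar .zero)))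
    (.and (.neg A.weaken) (.eq b.weaken (.bvar .zero)))))

theorem ite_inst {β : Ty n} (A : Term K (β :: Γ) Ty.t) (a b : Term K (β :: Γ) α) (c : Term K Γ β) :
    (ite A a b).inst c = ite (A.inst c) (a.inst c) (b.inst c) := by
  simp [ite, inst, subst, liftSubst]

end Term

namespace Prov

open Term

variable {n : ℕ} {K : Ty n → Type u} {Γ : List (Ty n)} {H : List (Term K Γ Ty.t)} {α : Ty n}

theorem ite_tt (a b : Term K Γ α) : Prov H (.eq (.ite .tt a b) a) := by
  refine (app_arg .iota (xi (propExt ?_ ?_))).trans (descr a)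
  · exact head.or_elim head.and_right (head.and_left.neg_elim tt_intro)
  · exact or_left (and_intro tt_intro head)

theorem ite_ff (a b : Term K Γ α) : Prov H (.eq (.ite .ff a b) b) := by
  refine (app_arg .iota (xi (propExt ?_ ?_))).trans (descr b)
  · exact head.or_elim head.and_left.ff_elim head.and_right
  · exact or_right (and_intro (refl _) head)

theorem ite_congr {A B : Term K Γ Ty.t} (a b : Term K Γ α) (h : Prov H (.eq A B)) :
    Prov H (.eq (.ite A a b) (.ite B a b)) := by
  have := congr (.ite (.bvar .zero) a.weaken b.weaken) h
  simp only [ite_inst, weaken_inst] at this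
  exact this

theorem ite_pos {A : Term K Γ Ty.t} (a b : Term K Γ α) (h : Prov H A) :
    Prov H (.eq (.ite A a b) a) := (ite_congr a b h.eq_tt).trans (ite_tt a b)

theorem ite_neg {A : Term K Γ Ty.t} (a b : Term K Γ α) (h : Prov H (.neg A)) :
    Prov H (.eq (.ite A a b) b) := (ite_congr a b h).trans (ite_ff a b)

/-- If `f b` is one of the `f a` for `a ∈ l`, a description selects such an `a`. -/
theorem exists_select {β : Ty n} (f : Term K (α :: Γ) β) (B : Term K Γ β) {l : List (Term K Γ α)}
    (hl : l ≠ []) : ∃ A : Term K Γ α, Prov [] (.app (.eqAny l) A) ∧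
      Prov [.app (.eqAny (l.map f.inst)) B] (.eq B (f.inst A)) := by
  induction l with
  | nil => exact absurd rfl hl
  | cons a l ih =>
    by_cases hl' : l = []
    · subst hl'
      refine ⟨a, eqAny_intro List.mem_cons_self (refl a), head.eqAny_elim fun c hc => ?_⟩
      simp only [List.map_cons, List.map_nil, List.mem_singleton] at hc
      exact hc ▸ head
    · obtain ⟨A, h₁, h₂⟩ := ih hl'
      refine ⟨.ite (.eq B (f.inst a)) a A, by_cases (.eq B (f.inst a)) ?_ ?_,
        by_cases (.eq B (f.inst a)) ?_ ?_⟩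
      · exact eqAny_intro List.mem_cons_self (ite_pos a A head)
      · refine (h₁.mono (List.nil_subset _)).eqAny_elim fun c hc => ?_
        exact eqAny_intro (List.mem_cons_of_mem _ hc) ((ite_neg a A head.weak).trans head)
      · exact head.trans (congr f (ite_pos a A head)).symm
      · refine trans ?_ (congr f (ite_neg a A head)).symm
        refine cut ?_ (h₂.mono (List.cons_subset_cons _ (List.nil_subset _)))
        refine eqAny_elim (head.weak) fun c hc => ?_
        rcases List.mem_cons.1 hc with rfl | hc
        · exact head.weak.neg_elim head
        · exact eqAny_intro hc head

end Prov
namespace Sig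

open Term

variable {n N : ℕ} [Fact (2 < n)] {S : Sig.{u} n N} {α : Ty n} {Γ : List (Ty n)}
  {H : List (Term S.Const Γ Ty.t)}

/-! ### The pairing of a context and a content -/

theorem pairCtx_subst {Δ : List (Ty n)} (σ : ∀ α : Ty n, BVar Γ α → Term S.Const Δ α)
    (x : Term S.Const Γ (Ty.c ⇒ Ty.c)) (y : Term S.Const Γ (Ty.c ⇒ α)) :
    (pairCtx x y).subst σ = pairCtx (x.subst σ) (y.subst σ) := by
  simp [pairCtx, subst, liftSubst]

theorem prov_pairCtx (p : Term S.Const Γ (Ty.ctx α)) :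
    Prov H (.eq (pairCtx (.lam (.fst (.app p.weaken (.bvar .zero))))
      (.lam (.snd (.app p.weaken (.bvar .zero))))) p) := by
  refine Prov.trans (Prov.xi ?_) (Prov.eta p)
  exact (Prov.pair_congr (Prov.app_weaken_lam _) (Prov.app_weaken_lam _)).trans (Prov.pair_eta _)

theorem prov_app_lam_snd (p : Term S.Const Γ (Ty.ctx α)) (C : Term S.Const Γ Ty.c) :
    Prov H (.eq (.app (.lam (.snd (.app p.weaken (.bvar .zero)))) C) (.snd (.app p C))) := by
  have := Prov.beta (H := H) (.snd (.app p.weaken (.bvar .zero))) C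
  simp only [inst, subst, weaken_subst_instSubst] at this
  exact this

theorem prov_snd_app_pairCtx (x : Term S.Const Γ (Ty.c ⇒ Ty.c)) (y : Term S.Const Γ (Ty.c ⇒ α))
    (C : Term S.Const Γ Ty.c) : Prov H (.eq (.snd (.app (pairCtx x y) C)) (.app y C)) := by
  have := Prov.beta (H := H) (.pair (.app x.weaken (.bvar .zero)) (.app y.weaken (.bvar .zero))) C
  simp only [inst, subst, weaken_subst_instSubst] at this
  exact (Prov.snd_congr this).trans (Prov.snd_pair _ _)

/-! ### The instantiation operator -/

/-- `∃ x_{cc}, ∃ y_{cα}, E (x_{cc}, y_{cα}) ∧ b = y_{cα} C`. -/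
def dnBody (E : Term S.Const Γ (Ty.ctx α ⇒ Ty.t)) (C : Term S.Const Γ Ty.c)
    (b : Term S.Const Γ α) : Term S.Const Γ Ty.t :=
  .ex (Ty.c ⇒ Ty.c) (.ex (Ty.c ⇒ α) (.and
    (.app E.weaken.weaken (pairCtx (.bvar (.succ .zero)) (.bvar .zero)))
    (.eq b.weaken.weaken (.app (.bvar .zero) C.weaken.weaken))))

theorem dnBody_subst {Δ : List (Ty n)} (σ : ∀ α : Ty n, BVar Γ α → Term S.Const Δ α)
    (E : Term S.Const Γ (Ty.ctx α ⇒ Ty.t)) (C : Term S.Const Γ Ty.c) (b : Term S.Const Γ α) :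
    (dnBody E C b).subst σ = dnBody (E.subst σ) (C.subst σ) (b.subst σ) := by
  simp only [dnBody, ex_subst, and_subst, subst, pairCtx_subst, weaken_subst_liftSubst]
  rfl

theorem prov_app_dnTm {H : List (S.Tm Ty.t)} (P : S.Tm (Ty.s ⇒ Ty.ctx α ⇒ Ty.t)) (C : S.Tm Ty.c)
    (w : S.Tm Ty.s) : Prov H (.eq (.app (dnTm P C) w)
      (.lam (dnBody (Term.app P w).weaken C.weaken (.bvar .zero)))) := by
  have h₁ := Prov.beta (H := H) (.lam (.lam (.lam (dnBody
    (.app (.bvar (.succ (.succ (.succ .zero)))) (.bvar (.succ .zero)))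
    (.bvar (.succ (.succ .zero))) (.bvar .zero))))) P
  have h₂ := Prov.beta (H := H) (.lam (.lam (dnBody
    (.app P.weaken.weaken.weaken (.bvar (.succ .zero)))
    (.bvar (.succ (.succ .zero))) (.bvar .zero)))) C
  have h₃ := Prov.beta (H := H) (.lam (dnBody
    (.app P.weaken.weaken (.bvar (.succ .zero))) C.weaken.weaken (.bvar .zero))) w
  simp only [inst, subst, dnBody_subst, liftSubst, instSubst, weaken_subst_liftSubst,
    weaken_subst_instSubst] at h₁ h₂ h₃
  exact (Prov.app_fun w ((Prov.app_fun C h₁).trans h₂)).trans h₃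

theorem prov_dnBody_intro {E : Term S.Const Γ (Ty.ctx α ⇒ Ty.t)} {C : Term S.Const Γ Ty.c}
    {b : Term S.Const Γ α} (p : Term S.Const Γ (Ty.ctx α)) (h : Prov H (.app E p))
    (h' : Prov H (.eq b (.snd (.app p C)))) : Prov H (dnBody E C b) := by
  refine Prov.ex_intro (.lam (.fst (.app p.weaken (.bvar .zero))))
    (Prov.ex_intro (.lam (.snd (.app p.weaken (.bvar .zero)))) ?_)
  simp only [inst, and_subst, subst, liftSubst, instSubst, pairCtx_subst,
    weaken_subst_liftSubst, weaken_subst_instSubst]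
  exact Prov.and_intro ((Prov.app_arg E (prov_pairCtx p)).symm.eq_mp h)
    (h'.trans (prov_app_lam_snd p C).symm)

theorem prov_dnBody_elim {l : List (Term S.Const Γ (Ty.ctx α))} {C : Term S.Const Γ Ty.c}
    {b : Term S.Const Γ α} (h : Prov H (dnBody (.eqAny l) C b)) :
    Prov H (.app (.eqAny (l.map fun a => .snd (.app a C))) b) := by
  refine Prov.ex_elim h (Prov.ex_elim Prov.head ?_)
  have e {β : Ty n} {Γ : List (Ty n)} (l : List (Term S.Const Γ (Ty.ctx α)))
      (C : Term S.Const Γ Ty.c) (b : Term S.Const Γ α) :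
      (Term.app (.eqAny (l.map fun a => Term.snd (.app a C))) b).weaken (β := β)
        = .app (.eqAny ((l.map weaken).map fun a => .snd (.app a C.weaken))) b.weaken := by
    rw [List.map_map]
    refine (congrArg (fun f => Term.app f b.weaken) (eqAny_weaken _)).trans ?_
    rw [List.map_map]
    rfl
  rw [e, e]
  refine Prov.eqAny_elim (b := pairCtx (.bvar (.succ .zero)) (.bvar .zero))
    (l := (l.map weaken).map weaken) ?_ fun a ha => ?_
  · rw [← eqAny_weaken, ← eqAny_weaken]
    exact Prov.head.and_left
  · refine Prov.eqAny_intro (List.mem_map_of_mem ha) ?_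
    refine (Prov.head.weak.and_right).trans ((prov_snd_app_pairCtx (.bvar (.succ .zero)) _ _).symm.trans ?_)
    exact Prov.snd_congr (Prov.app_fun _ Prov.head)

/-- If `E` is a finite disjunction of the predicates `(= a)`, then `E ↓ C` is the disjunction of
the predicates `(= π₂ (a C))`. -/
theorem prov_lam_dnBody (l : List (Term S.Const Γ (Ty.ctx α))) (C : Term S.Const Γ Ty.c) :
    Prov H (.eq (.lam (dnBody (eqAny l).weaken C.weaken (.bvar .zero)))
      (.eqAny (l.map fun a => .snd (.app a C)))) := by
  have e : (eqAny (l.map fun a => Term.snd (.app a C))).weaken (β := α)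
      = .eqAny ((l.map weaken).map fun a => .snd (.app a C.weaken)) := by
    rw [eqAny_weaken, List.map_map, List.map_map]
    rfl
  refine Prov.trans (Prov.xi (Prov.propExt ?_ ?_)) (Prov.eta _)
  · rw [e]
    refine prov_dnBody_elim ?_
    rw [← eqAny_weaken]
    exact Prov.head
  · rw [e]
    refine Prov.head.eqAny_elim fun a ha => ?_
    obtain ⟨p, hp, rfl⟩ := List.mem_map.1 ha
    refine prov_dnBody_intro p ?_ Prov.head
    rw [eqAny_weaken]
    exact Prov.eqAny_intro hp (Prov.refl p)

theorem prov_app_dnTm_of_eqAny {H : List (S.Tm Ty.t)} {P : S.Tm (Ty.s ⇒ Ty.ctx α ⇒ Ty.t)}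
    (C : S.Tm Ty.c) {w : S.Tm Ty.s} {l : List (S.Tm (Ty.ctx α))}
    (h : Prov H (.eq (.app P w) (.eqAny l))) :
    Prov H (.eq (.app (dnTm P C) w) (.eqAny (l.map fun a => .snd (.app a C)))) := by
  have h' := Prov.congr (.lam (dnBody (Term.bvar .zero).weaken C.weaken.weaken (.bvar .zero))) h
  simp only [inst, subst, dnBody_subst, weaken_subst_liftSubst, weaken_subst_instSubst,
    liftSubst, instSubst] at h'
  refine (prov_app_dnTm P C w).trans (Prov.trans ?_ (prov_lam_dnBody l C))
  exact h'

/-- `CI(C)`, as a predicate of a pair, relates `p` to `π₂ (p C)` only. -/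
theorem prov_uncurryCtx_ciTm {H : List (S.Tm Ty.t)} (C : S.Tm Ty.c) (p : S.Tm (Ty.ctx α))
    (b : S.Tm α) : Prov H (.eq (.app (.app (uncurryCtx (ciTm C)) p) b)
      (.eq b (.snd (.app p C)))) := by
  have h₁ := Prov.beta (H := H) (.app (.app (ciTm (α := α) C).lift
    (.lam (.fst (.app (.bvar (.succ .zero)) (.bvar .zero)))))
    (.lam (.snd (.app (.bvar (.succ .zero)) (.bvar .zero))))) p
  simp only [inst, subst, lift_subst, liftSubst, instSubst, lift_nil] at h₁
  have h₂ := Prov.beta (H := H) (.lam (Term.eqTo (α := α) (.app (.bvar .zero) C.lift)))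
    (.lam (.fst (.app p.weaken (.bvar .zero))))
  have h₃ := Prov.beta (H := H) (Term.eqTo (.app (.bvar .zero) C.lift))
    (.lam (.snd (.app p.weaken (.bvar .zero))))
  simp only [inst, subst, eqTo_subst, lift_subst, liftSubst, instSubst, lift_nil] at h₂ h₃
  refine (Prov.app_fun b (h₁.trans ((Prov.app_fun _ h₂).trans h₃))).trans ?_
  exact (Prov.eqTo_iff _ b).trans (Prov.eq_congr (Prov.refl b) (prov_app_lam_snd p C))

/-! ### Derivability from a theory -/

theorem Derives.of_prov {Δ : Set (S.Tm Ty.t)} {A : S.Tm Ty.t} (h : Prov [] A) : S.Derives Δ A :=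
  ⟨[], by simp, h⟩

theorem Derives.map {Δ : Set (S.Tm Ty.t)} {A B : S.Tm Ty.t} (h : S.Derives Δ A)
    (f : ∀ {H : List (S.Tm Ty.t)}, Prov H A → Prov H B) : S.Derives Δ B := by
  obtain ⟨H, hH, hA⟩ := h
  exact ⟨H, hH, f hA⟩

theorem Derives.map₂ {Δ : Set (S.Tm Ty.t)} {A B G : S.Tm Ty.t} (h : S.Derives Δ A)
    (h' : S.Derives Δ B) (f : ∀ {H : List (S.Tm Ty.t)}, Prov H A → Prov H B → Prov H G) :
    S.Derives Δ G := by
  obtain ⟨H, hH, hA⟩ := h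
  obtain ⟨H', hH', hB⟩ := h'
  refine ⟨H ++ H', fun B hB => ?_, f (hA.mono (List.subset_append_left _ _))
    (hB.mono (List.subset_append_right _ _))⟩
  exact (List.mem_append.1 hB).elim (hH B) (hH' B)

theorem incl_app_eqAny (D : Ty n → Type v) (l : List (S.Tm α)) (b : S.Tm α) :
    S.incl D (.app (.eqAny l) b) = .app (.eqAny (l.map (S.incl D))) (S.incl D b) := by
  simp only [incl, mapConst, mapConst_eqAny]
  rfl

/-- Context instantiation preserves pseudo-canonic representations. -/
theorem Lang.PseudoCanonic.instantiate {D : Ty n → Type v} {L : S.CtxLang α}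
    {Δ : Set ((S.extend D).Tm Ty.t)} {P : (S.extend D).Tm (Ty.s ⇒ Ty.ctx α ⇒ Ty.t)}
    (hL : Lang.PseudoCanonic L Δ P) (C : S.Tm Ty.c) :
    Lang.PseudoCanonic (CtxLang.instantiate L C) Δ (dnTm P (S.incl D C)) := by
  obtain ⟨⟨hcons, hrep⟩, hfin, hconv⟩ := hL
  have hmap (l : List (S.Tm (Ty.ctx α))) :
      (l.map (S.incl D)).map (fun a => Term.snd (.app a (S.incl D C)))
        = (l.map fun a => Term.snd (.app a C)).map (S.incl D) := by
    rw [List.map_map, List.map_map]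
    rfl
  have hdn (w : List (Fin N)) (l : List (S.Tm (Ty.ctx α)))
      (hl : (S.extend D).Derives Δ
        (.eq (.app P ((S.extend D).wordTm w)) (Term.eqAny (l.map (S.incl D))))) :
      (S.extend D).Derives Δ (.eq (.app (dnTm P (S.incl D C)) ((S.extend D).wordTm w))
        (Term.eqAny ((l.map fun a => Term.snd (.app a C)).map (S.incl D)))) := by
    refine hl.map fun h => ?_
    rw [← hmap]
    exact prov_app_dnTm_of_eqAny _ h
  refine ⟨⟨hcons, fun w B => ?_⟩, fun w => ?_, hconv⟩
  · obtain ⟨l, hl⟩ := hfin w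
    have hl' := hdn w l hl
    constructor
    · rintro ⟨A, hA, hAB⟩
      have hE := hl.map₂ ((hrep w A).1 hA) fun h h' => (Prov.app_fun _ h).eq_mp h'
      have hB := (hconv _).1 (Derives.map hAB fun h => (prov_uncurryCtx_ciTm C A B).eq_mp h)
      refine hl'.map₂ (hE.map₂ hB fun h h' => ?_) fun h h' => (Prov.app_fun _ h).symm.eq_mp h'
      rw [← hmap]
      refine Prov.eqAny_elim h fun a ha => Prov.eqAny_intro (List.mem_map_of_mem ha) ?_
      exact Prov.trans (Prov.weak h') (Prov.snd_congr (Prov.app_fun _ Prov.head))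
    · intro hB
      have hany := hl'.map₂ hB fun h h' => (Prov.app_fun _ h).eq_mp h'
      rw [← incl_app_eqAny] at hany
      have hany' := (hconv _).2 hany
      have hne : l ≠ [] := by
        rintro rfl
        exact hcons (hany.map fun h => (Prov.eqAny_nil _).eq_mp h)
      obtain ⟨A, h₁, h₂⟩ := Prov.exists_select (.snd (.app (.bvar .zero) C.weaken)) B hne
      have hf : (Term.snd (.app (.bvar .zero) C.weaken)).inst
          = fun a : S.Tm (Ty.ctx α) => Term.snd (.app a C) := by
        funext a
        simp only [Term.inst, Term.subst, Term.instSubst, Term.weaken_subst_instSubst]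
      rw [hf] at h₂
      refine ⟨A, (hrep w A).2 ?_, ?_⟩
      · have hA := (hconv _).1 (Derives.of_prov h₁)
        rw [incl_app_eqAny] at hA
        exact hl.map₂ hA fun h h' => (Prov.app_fun _ h).symm.eq_mp h'
      · refine Derives.map hany' fun h => (prov_uncurryCtx_ciTm C A B).symm.eq_mp ?_
        exact Prov.cut h (h₂.mono (List.cons_subset_cons _ (List.nil_subset _)))
  · obtain ⟨l, hl⟩ := hfin w
    exact ⟨_, hdn w l hl⟩

end Sig

end TyN

theorem proposition9p3 {n N : ℕ} [Fact (2 < n)] (S : TyN.Sig.{u} n N)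
    (D : TyN.Ty n → Type v) (α : TyN.Ty n) (L : S.CtxLang α)
    (Δ : Set ((S.extend D).Tm TyN.Ty.t))
    (P : (S.extend D).Tm (TyN.Ty.s ⇒ TyN.Ty.ctx α ⇒ TyN.Ty.t)) (C : S.Tm TyN.Ty.c)
    (hL : TyN.Sig.Lang.PseudoCanonic L Δ P) :
    TyN.Sig.Lang.PseudoCanonic (TyN.Sig.CtxLang.instantiate L C) Δ
      (TyN.Sig.dnTm P (S.incl D C)) :=
  hL.instantiate C
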